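/- Let $m\ge 1$ and $d>2m$ be integers. Let $(G_n)_{n\ge m}$ be the following random graph process: $G_m$ is the complete graph on $m$ vertices and, for $n\ge m$, given $G_m,\dots,G_n$, the graph $G_{n+1}$ is obtained from $G_n$ by adding a new vertex and joining it to the $m$ vertices of a set chosen uniformly at random among all $m$-element sets of vertices of $G_n$ of degree less than $d$. For $m\le k\le d$, let $N_k(n)$ be the number of vertices of degree $k$ in $G_n$ and let $X_k(n)=N_k(n)/n$. The equation $$\left(\frac{m}{m+1-x}\right)^{d-m}=x$$ has a unique root $x=\rho_d$ in the interval $(0,2m/d)$. Put $$\rho_k=\frac{(1-\rho_d)\,m^{k-m}}{(m+1-\rho_d)^{k-m+1}},\qquad k=m,\dots,d-1.$$ Then almost surely, for every $k\in\{m,\dots,d\}$, $X_k(n)\to\rho_k$ as $n\to\infty$ and, for every $\delta>0$, $|X_k(n)-\rho_k|=o(n^{-1/2+\delta})$. -/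

import Mathlib

open MeasureTheory Filter Topology Asymptotics

/-- The vertices of `G` whose degree is less than `d`. -/
noncomputable def eligibleVertices (d : ℕ) {n : ℕ} (G : SimpleGraph (Fin n)) : Finset (Fin n) :=
  open Classical in Finset.univ.filter fun v => G.degree v < d

/-- The graph obtained from `G` by adding one new vertex (the last one) and joining it to exactly
the vertices in `S`. -/
def addVertex {n : ℕ} (G : SimpleGraph (Fin n)) (S : Finset (Fin n)) :
    SimpleGraph (Fin (n + 1)) :=
  G.map Fin.castSuccEmb ⊔
    SimpleGraph.fromRel fun a b => a = Fin.last n ∧ ∃ v ∈ S, b = Fin.castSucc v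

/-- `(G n)`, `n ≥ m`, is a uniform attachment process with parameter `m` and degrees bounded by `d`:
`G m` is the complete graph on `m` vertices and, given `G m, …, G n`, the graph `G (n + 1)` arises
from `G n` by joining a new vertex to a uniformly random `m`-element set of vertices of degree
less than `d`. -/
structure IsBoundedUniformAttachment {Ω : Type*} [MeasurableSpace Ω] (μ : Measure Ω) (m d : ℕ)
    (G : (n : ℕ) → Ω → SimpleGraph (Fin n)) : Prop where
  measurableSet_eq : ∀ n, m ≤ n → ∀ H : SimpleGraph (Fin n), MeasurableSet {ω | G n ω = H}
  initial : ∀ᵐ ω ∂μ, G m ω = ⊤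
  step : ∀ n, m ≤ n → ∀ g : (i : ℕ) → SimpleGraph (Fin i),
    ∀ S ∈ (eligibleVertices d (g n)).powersetCard m,
      μ.real {ω | (∀ i ∈ Finset.Icc m n, G i ω = g i) ∧ G (n + 1) ω = addVertex (g n) S} =
        μ.real {ω | ∀ i ∈ Finset.Icc m n, G i ω = g i} *
          (1 / ((eligibleVertices d (g n)).card.choose m : ℝ))

/-- The number of vertices of degree `k`. -/
noncomputable def numDegree (k : ℕ) {n : ℕ} (G : SimpleGraph (Fin n)) : ℕ :=
  open Classical in (Finset.univ.filter fun v => G.degree v = k).card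

/-- `x` is a root in `(0, 2m/d)` of `(m / (m + 1 - x)) ^ (d - m) = x`. -/
def IsTopRoot (m d : ℕ) (x : ℝ) : Prop :=
  x ∈ Set.Ioo (0 : ℝ) (2 * m / d) ∧ ((m : ℝ) / (m + 1 - x)) ^ (d - m) = x

/-- The limiting proportion of vertices of degree `k`, `m ≤ k ≤ d`, where `x` is the limiting
proportion of vertices of degree `d`. -/
noncomputable def limitProportion (m d : ℕ) (x : ℝ) (k : ℕ) : ℝ :=
  if k = d then x else (1 - x) * (m : ℝ) ^ (k - m) / ((m : ℝ) + 1 - x) ^ (k - m + 1)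

section AddVertex

variable {n : ℕ} (G : SimpleGraph (Fin n)) (S : Finset (Fin n))

theorem addVertex_adj_castSucc (u v : Fin n) :
    (addVertex G S).Adj u.castSucc v.castSucc ↔ G.Adj u v := by
  simp only [addVertex, SimpleGraph.sup_adj, SimpleGraph.map_adj, SimpleGraph.fromRel_adj]
  constructor
  · rintro (⟨a, b, h, ha, hb⟩ | ⟨-, ⟨h, -⟩ | ⟨h, -⟩⟩)
    · simp only [Fin.coe_castSuccEmb, Fin.castSucc_inj] at ha hb
      rwa [← ha, ← hb]
    · exact absurd h (Fin.castSucc_ne_last _)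
    · exact absurd h (Fin.castSucc_ne_last _)
  · exact fun h => Or.inl ⟨u, v, h, rfl, rfl⟩

theorem addVertex_adj_last (v : Fin n) :
    (addVertex G S).Adj (Fin.last n) v.castSucc ↔ v ∈ S := by
  simp only [addVertex, SimpleGraph.sup_adj, SimpleGraph.map_adj, SimpleGraph.fromRel_adj]
  constructor
  · rintro (⟨a, b, h, ha, hb⟩ | ⟨-, ⟨-, w, hw, h⟩ | ⟨h, -⟩⟩)
    · exact absurd ha (Fin.castSucc_ne_last _)
    · rwa [Fin.castSucc_inj.1 h]
    · exact absurd h (Fin.castSucc_ne_last _)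
  · exact fun h => Or.inr ⟨(Fin.castSucc_ne_last v).symm, Or.inl ⟨trivial, v, h, rfl⟩⟩

theorem addVertex_injective : Function.Injective (addVertex G) := by
  intro S T h
  ext v
  rw [← addVertex_adj_last G S, ← addVertex_adj_last G T, h]

open Classical in
theorem degree_eq_sum_adj {n : ℕ} (G : SimpleGraph (Fin n)) (v : Fin n) :
    G.degree v = ∑ u, if G.Adj v u then 1 else 0 := by
  rw [← SimpleGraph.card_neighborFinset_eq_degree, Finset.sum_boole]
  simp only [Nat.cast_id]
  congr 1
  ext u
  simp

open Classical in
theorem degree_addVertex_castSucc (v : Fin n) :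
    (addVertex G S).degree v.castSucc = G.degree v + if v ∈ S then 1 else 0 := by
  rw [degree_eq_sum_adj, degree_eq_sum_adj, Fin.sum_univ_castSucc]
  simp only [addVertex_adj_castSucc, SimpleGraph.adj_comm _ v.castSucc (Fin.last n),
    addVertex_adj_last]

open Classical in
theorem degree_addVertex_last : (addVertex G S).degree (Fin.last n) = S.card := by
  rw [degree_eq_sum_adj, Fin.sum_univ_castSucc]
  simp [addVertex_adj_last]

end AddVertex

section Counting

variable {n : ℕ}

open Classical in
theorem numDegree_eq_sum (k : ℕ) (G : SimpleGraph (Fin n)) :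
    (numDegree k G : ℝ) = ∑ v, if G.degree v = k then 1 else 0 := by
  rw [Finset.sum_boole, numDegree]

open Classical in
theorem mem_eligibleVertices {d : ℕ} {G : SimpleGraph (Fin n)} {v : Fin n} :
    v ∈ eligibleVertices d G ↔ G.degree v < d := by
  simp [eligibleVertices]

open Classical in
/-- Change of the number of vertices of degree `k` when a vertex is added. -/
theorem numDegree_addVertex (k : ℕ) (G : SimpleGraph (Fin n)) (S : Finset (Fin n)) :
    (numDegree k (addVertex G S) : ℝ) = numDegree k G + (if S.card = k then 1 else 0) +
      ∑ v ∈ S, ((if G.degree v + 1 = k then 1 else 0) - if G.degree v = k then 1 else 0) := by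
  rw [numDegree_eq_sum, numDegree_eq_sum, Fin.sum_univ_castSucc]
  simp only [degree_addVertex_castSucc, degree_addVertex_last]
  rw [← Finset.sum_filter_add_sum_filter_not Finset.univ (· ∈ S),
    ← Finset.sum_filter_add_sum_filter_not Finset.univ (· ∈ S)
      (fun v => if G.degree v = k then (1 : ℝ) else 0), Finset.filter_univ_mem,
      Finset.sum_sub_distrib]
  rw [Finset.sum_congr rfl (g := fun v => if G.degree v + 1 = k then (1 : ℝ) else 0)
    (fun v hv => by simp [hv])]
  rw [Finset.sum_congr (s₁ := Finset.univ.filter (· ∉ S)) rfl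
    (g := fun v => if G.degree v = k then (1 : ℝ) else 0)
    (fun v hv => by simp [(Finset.mem_filter.1 hv).2])]
  ring

theorem abs_numDegree_addVertex_sub_le (k : ℕ) (G : SimpleGraph (Fin n)) (S : Finset (Fin n)) :
    |(numDegree k (addVertex G S) : ℝ) - numDegree k G| ≤ S.card + 1 := by
  classical
  rw [numDegree_addVertex]
  have h1 : |∑ v ∈ S, ((if G.degree v + 1 = k then (1 : ℝ) else 0) -
      if G.degree v = k then 1 else 0)| ≤ S.card := by
    refine (Finset.abs_sum_le_sum_abs _ _).trans ?_
    refine (Finset.sum_le_card_nsmul _ _ 1 fun v _ => ?_).trans (by simp)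
    split_ifs <;> simp
  have h2 : |(if S.card = k then (1 : ℝ) else 0)| ≤ 1 := by split_ifs <;> simp
  calc _ = |(if S.card = k then (1 : ℝ) else 0) + ∑ v ∈ S, ((if G.degree v + 1 = k then (1 : ℝ)
        else 0) - if G.degree v = k then 1 else 0)| := by congr 1; ring
    _ ≤ _ := (abs_add_le _ _).trans (by linarith)

/-- Double counting of the pairs `v ∈ S` with `S` an `m`-subset of `A`. -/
theorem sum_powersetCard_sum {α : Type*} [DecidableEq α] (A : Finset α) (m : ℕ) (f : α → ℝ) :
    (A.card : ℝ) * ∑ S ∈ A.powersetCard m, ∑ v ∈ S, f v =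
      m * A.card.choose m * ∑ v ∈ A, f v := by
  have h1 : ∑ S ∈ A.powersetCard m, ∑ v ∈ S, f v =
      ∑ v ∈ A, ∑ S ∈ (A.powersetCard m).filter (v ∈ ·), f v := by
    rw [Finset.sum_comm' (t' := A) (s' := fun v => (A.powersetCard m).filter (v ∈ ·))]
    intro S v
    simp only [Finset.mem_filter, Finset.mem_powersetCard]
    exact ⟨fun h => ⟨⟨h.1, h.2⟩, h.1.1 h.2⟩, fun h => ⟨h.1.1, h.1.2⟩⟩
  have h2 : ∀ v ∈ A, (A.card : ℝ) * ((A.powersetCard m).filter (v ∈ ·)).card =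
      m * A.card.choose m := by
    intro v hv
    obtain _ | m := m
    · simp
    have : (A.powersetCard (m + 1)).filter (v ∈ ·) =
        ((A.erase v).powersetCard m).image (insert v) := by
      ext S
      simp only [Finset.mem_filter, Finset.mem_powersetCard, Finset.mem_image]
      constructor
      · rintro ⟨⟨h, hc⟩, hS⟩
        exact ⟨S.erase v, ⟨Finset.erase_subset_erase _ h, by
          rw [Finset.card_erase_of_mem hS, hc]; rfl⟩, Finset.insert_erase hS⟩
      · rintro ⟨T, ⟨h, hc⟩, rfl⟩
        have hT : v ∉ T := fun h' => Finset.notMem_erase v A (h h')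
        refine ⟨⟨Finset.insert_subset hv (h.trans (Finset.erase_subset _ _)), ?_⟩, by simp⟩
        rw [Finset.card_insert_of_notMem hT, hc]
    rw [this, Finset.card_image_of_injOn, Finset.card_powersetCard, Finset.card_erase_of_mem hv]
    · have hA : A.card = A.card - 1 + 1 := by
        have := Finset.card_pos.2 ⟨v, hv⟩
        omega
      have := Nat.add_one_mul_choose_eq (A.card - 1) m
      rw [← hA] at this
      rw [mul_comm ((m + 1 : ℕ) : ℝ)]
      exact_mod_cast this
    · intro T hT T' hT' h
      have hT1 : v ∉ T := fun h' => Finset.notMem_erase v A ((Finset.mem_powersetCard.1 hT).1 h')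
      have hT2 : v ∉ T' := fun h' => Finset.notMem_erase v A ((Finset.mem_powersetCard.1 hT').1 h')
      rw [← Finset.erase_insert hT1, ← Finset.erase_insert hT2, h]
  rw [h1, Finset.mul_sum, Finset.mul_sum]
  refine Finset.sum_congr rfl fun v hv => ?_
  rw [Finset.sum_const, nsmul_eq_mul, ← mul_assoc, h2 v hv]

end Counting

/-- The conditional mean of `φ (G (n + 1))` given that `G n = H`. -/
noncomputable def stepMean (m d : ℕ) {n : ℕ} (φ : SimpleGraph (Fin (n + 1)) → ℝ)
    (H : SimpleGraph (Fin n)) : ℝ :=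
  (∑ S ∈ (eligibleVertices d H).powersetCard m, φ (addVertex H S)) /
    ((eligibleVertices d H).card.choose m : ℝ)

theorem abs_stepMean_sub_le {m d n : ℕ} (φ : SimpleGraph (Fin (n + 1)) → ℝ)
    (H : SimpleGraph (Fin n)) (hH : m ≤ (eligibleVertices d H).card) (r c : ℝ)
    (h : ∀ S ∈ (eligibleVertices d H).powersetCard m, |φ (addVertex H S) - r| ≤ c) :
    |stepMean m d φ H - r| ≤ c := by
  have hC : (0 : ℝ) < (eligibleVertices d H).card.choose m := by
    exact_mod_cast Nat.choose_pos hH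
  have : stepMean m d φ H - r = (∑ S ∈ (eligibleVertices d H).powersetCard m,
      (φ (addVertex H S) - r)) / ((eligibleVertices d H).card.choose m : ℝ) := by
    rw [stepMean, Finset.sum_sub_distrib, Finset.sum_const, Finset.card_powersetCard,
      nsmul_eq_mul]
    field_simp
  rw [this, abs_div, abs_of_pos hC, div_le_iff₀ hC]
  refine (Finset.abs_sum_le_sum_abs _ _).trans ((Finset.sum_le_card_nsmul _ _ c h).trans ?_)
  rw [Finset.card_powersetCard, nsmul_eq_mul, mul_comm]

open Classical in
theorem stepMean_numDegree {m d n : ℕ} (hm : 1 ≤ m) (k : ℕ) (H : SimpleGraph (Fin n))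
    (hH : m ≤ (eligibleVertices d H).card) :
    stepMean m d (fun H' => (numDegree k H' : ℝ)) H - numDegree k H =
      (if m = k then 1 else 0) + m / (eligibleVertices d H).card *
        ∑ v ∈ eligibleVertices d H,
          ((if H.degree v + 1 = k then 1 else 0) - if H.degree v = k then 1 else 0) := by
  have hC : (0 : ℝ) < (eligibleVertices d H).card.choose m := by
    exact_mod_cast Nat.choose_pos hH
  have hE : (0 : ℝ) < (eligibleVertices d H).card := by
    exact_mod_cast hm.trans hH
  have key := sum_powersetCard_sum (eligibleVertices d H) m (fun v =>
    ((if H.degree v + 1 = k then (1 : ℝ) else 0) - if H.degree v = k then 1 else 0))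
  have h1 : ∀ S ∈ (eligibleVertices d H).powersetCard m, (numDegree k (addVertex H S) : ℝ) =
      (numDegree k H + if m = k then 1 else 0) + ∑ v ∈ S, ((if H.degree v + 1 = k then (1 : ℝ)
        else 0) - if H.degree v = k then 1 else 0) := fun S hS => by
    rw [numDegree_addVertex, (Finset.mem_powersetCard.1 hS).2]
  rw [stepMean, Finset.sum_congr rfl h1, Finset.sum_add_distrib, Finset.sum_const,
    Finset.card_powersetCard, nsmul_eq_mul]
  generalize (∑ S ∈ (eligibleVertices d H).powersetCard m, ∑ v ∈ S,
    ((if H.degree v + 1 = k then (1 : ℝ) else 0) - if H.degree v = k then 1 else 0)) = A at *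
  generalize (∑ v ∈ eligibleVertices d H,
    ((if H.degree v + 1 = k then (1 : ℝ) else 0) - if H.degree v = k then 1 else 0)) = B at *
  field_simp
  linear_combination key

open Classical in
theorem sum_eligibleVertices_boole {d n k : ℕ} (hk : k < d) (H : SimpleGraph (Fin n)) :
    (∑ v ∈ eligibleVertices d H, if H.degree v = k then (1 : ℝ) else 0) = numDegree k H := by
  rw [numDegree_eq_sum, eligibleVertices, Finset.sum_filter]
  refine Finset.sum_congr rfl fun v _ => ?_
  split_ifs <;> first | rfl | omega

open Classical in
theorem degree_of_eq_top {n : ℕ} {H : SimpleGraph (Fin n)} (h : H = ⊤) (v : Fin n) :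
    H.degree v = n - 1 := by
  subst h
  convert SimpleGraph.complete_graph_degree v
  simp

/-- The graphs which the process can reach. -/
inductive Reachable (m d : ℕ) : (n : ℕ) → SimpleGraph (Fin n) → Prop
  | base : Reachable m d m ⊤
  | step {n : ℕ} {H : SimpleGraph (Fin n)} {S : Finset (Fin n)} (h : Reachable m d n H)
      (hS : S ∈ (eligibleVertices d H).powersetCard m) : Reachable m d (n + 1) (addVertex H S)

namespace Reachable

variable {m d n : ℕ} {H : SimpleGraph (Fin n)}

theorem le (h : Reachable m d n H) : m ≤ n := by
  induction h with
  | base => exact le_rfl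
  | step _ _ ih => exact ih.trans (Nat.le_succ _)

open Classical in
theorem degree_le (hd : 2 * m < d) (h : Reachable m d n H) (v : Fin n) : H.degree v ≤ d := by
  induction h with
  | base => rw [degree_of_eq_top rfl]; omega
  | @step n H S h hS ih =>
    rw [Finset.mem_powersetCard] at hS
    induction v using Fin.lastCases with
    | last => rw [degree_addVertex_last]; omega
    | cast v =>
      rw [degree_addVertex_castSucc]
      split_ifs with hv
      · exact mem_eligibleVertices.1 (hS.1 hv)
      · exact ih v

open Classical in
theorem le_degree_add_one (h : Reachable m d n H) (v : Fin n) : m ≤ H.degree v + 1 := by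
  induction h with
  | base => rw [degree_of_eq_top rfl]; omega
  | @step n H S h hS ih =>
    induction v using Fin.lastCases with
    | last => rw [degree_addVertex_last, (Finset.mem_powersetCard.1 hS).2]; omega
    | cast v =>
      rw [degree_addVertex_castSucc]
      have := ih v
      omega

open Classical in
theorem le_degree (h : Reachable m d n H) (hn : m < n) (v : Fin n) : m ≤ H.degree v := by
  induction h with
  | base => omega
  | @step n H S h hS ih =>
    have hS' := (Finset.mem_powersetCard.1 hS).2
    induction v using Fin.lastCases with
    | last => rw [degree_addVertex_last, hS']
    | cast v =>
      rw [degree_addVertex_castSucc]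
      obtain hmn | hmn := h.le.eq_or_lt
      · have : S = Finset.univ := (Finset.card_eq_iff_eq_univ S).1 (by simp [hS', hmn])
        have := h.le_degree_add_one v
        simp_all
      · have := ih hmn v
        omega

open Classical in
theorem sum_degree (h : Reachable m d n H) : ∑ v, H.degree v + m * (m + 1) = 2 * m * n := by
  induction h with
  | base =>
    rw [Finset.sum_congr rfl fun v _ => degree_of_eq_top rfl v]
    simp only [Finset.sum_const, Finset.card_univ, Fintype.card_fin, smul_eq_mul]
    obtain _ | m := m
    · simp
    · simp only [Nat.add_sub_cancel]; ring
  | @step n H S h hS ih =>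
    rw [Fin.sum_univ_castSucc]
    simp only [degree_addVertex_castSucc, degree_addVertex_last, Finset.sum_add_distrib]
    rw [(Finset.mem_powersetCard.1 hS).2]
    simp [(Finset.mem_powersetCard.1 hS).2]
    linarith

theorem card_le_mul_card_eligibleVertices (hd : 2 * m < d) (h : Reachable m d n H) (hn : m < n) :
    n + m * (m + 1) ≤ (m + 1) * (eligibleVertices d H).card := by
  classical
  have h1 := h.sum_degree
  have h2 : n * (2 * m + 1) ≤
      ∑ v, (H.degree v + if v ∈ eligibleVertices d H then m + 1 else 0) := by
    refine le_trans (by simp) (Finset.card_nsmul_le_sum Finset.univ _ (2 * m + 1) fun v _ => ?_)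
    have := h.le_degree hn v
    split_ifs with hv <;> rw [mem_eligibleVertices] at hv <;> omega
  rw [Finset.sum_add_distrib] at h2
  simp at h2
  linarith

theorem le_card_eligibleVertices (hd : 2 * m < d) (h : Reachable m d n H) :
    m ≤ (eligibleVertices d H).card := by
  classical
  obtain hmn | hmn := h.le.eq_or_lt
  · have : eligibleVertices d H = Finset.univ := by
      ext v
      have := H.degree_lt_card_verts v
      simp only [Fintype.card_fin] at this
      simp only [mem_eligibleVertices, Finset.mem_univ, iff_true]
      omega
    simp [this, hmn]
  · have := h.card_le_mul_card_eligibleVertices hd hmn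
    by_contra! hlt
    nlinarith

open Classical in
theorem sum_mul_numDegree (h : Reachable m d n H) (hn : m < n) (g : ℕ → ℝ) :
    ∑ i ∈ Finset.range (d - m), g i * numDegree (m + i) H =
      ∑ v ∈ eligibleVertices d H, g (H.degree v - m) := by
  simp only [numDegree_eq_sum, Finset.mul_sum]
  rw [Finset.sum_comm, eligibleVertices, Finset.sum_filter]
  refine Finset.sum_congr rfl fun v _ => ?_
  have := h.le_degree hn v
  split_ifs with hv
  · rw [Finset.sum_eq_single (H.degree v - m), if_pos (by omega), mul_one]
    · intro i _ hi
      rw [if_neg (by omega), mul_zero]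
    · intro hi
      exact absurd (Finset.mem_range.2 (by omega)) hi
  · refine Finset.sum_eq_zero fun i hi => ?_
    rw [Finset.mem_range] at hi
    rw [if_neg (by omega), mul_zero]

theorem sum_numDegree (h : Reachable m d n H) (hn : m < n) :
    ∑ i ∈ Finset.range (d - m), (numDegree (m + i) H : ℝ) = (eligibleVertices d H).card := by
  simpa using h.sum_mul_numDegree hn fun _ => 1

theorem sum_sub_mul_numDegree (hd : 2 * m < d) (h : Reachable m d n H) (hn : m < n) :
    ∑ i ∈ Finset.range (d - m), ((d : ℝ) - m - i) * numDegree (m + i) H =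
      (d - 2 * m) * n + m * (m + 1) := by
  classical
  rw [h.sum_mul_numDegree hn fun i => (d : ℝ) - m - i, eligibleVertices, Finset.sum_filter]
  have h1 : ∀ v ∈ Finset.univ, (if H.degree v < d then (d : ℝ) - m - (H.degree v - m : ℕ) else 0) =
      d - H.degree v := by
    intro v _
    have h2 := h.le_degree hn v
    have h3 := h.degree_le hd v
    split_ifs with hv
    · push_cast [h2]; ring
    · rw [le_antisymm h3 (not_lt.1 hv), sub_self]
  rw [Finset.sum_congr rfl h1, Finset.sum_sub_distrib]
  have h4 : (∑ v, (H.degree v : ℝ)) + m * (m + 1) = 2 * m * n := by exact_mod_cast h.sum_degree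
  simp
  linarith

theorem numDegree_top (hd : 2 * m < d) (h : Reachable m d n H) :
    (numDegree d H : ℝ) = n - (eligibleVertices d H).card := by
  classical
  rw [eq_sub_iff_add_eq, numDegree, eligibleVertices, ← Nat.cast_add,
    ← Finset.card_union_of_disjoint]
  · rw [← Finset.filter_or, Finset.filter_true_of_mem]
    · simp
    · intro v _
      exact (h.degree_le hd v).eq_or_lt
  · rw [Finset.disjoint_filter]
    intro v _ h1 h2
    omega

theorem stepMean_numDegree_bot (hm : 1 ≤ m) (hd : 2 * m < d) (h : Reachable m d n H)
    (hn : m < n) :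
    stepMean m d (fun H' => (numDegree m H' : ℝ)) H - numDegree m H =
      m / (eligibleVertices d H).card * ((eligibleVertices d H).card / m - numDegree m H) := by
  classical
  have hE := h.le_card_eligibleVertices hd
  rw [stepMean_numDegree hm m H hE, Finset.sum_sub_distrib,
    sum_eligibleVertices_boole (by omega : m < d), if_pos rfl, Finset.sum_eq_zero]
  · have h1 : (0 : ℝ) < m := by exact_mod_cast hm
    have h2 : (0 : ℝ) < (eligibleVertices d H).card := by exact_mod_cast hm.trans hE
    field_simp
    ring
  · intro v _
    have := h.le_degree hn v
    rw [if_neg (by omega)]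

theorem stepMean_numDegree_succ (hm : 1 ≤ m) (hd : 2 * m < d) (h : Reachable m d n H)
    {k : ℕ} (hk : m ≤ k) (hkd : k + 1 < d) :
    stepMean m d (fun H' => (numDegree (k + 1) H' : ℝ)) H - numDegree (k + 1) H =
      m / (eligibleVertices d H).card * (numDegree k H - numDegree (k + 1) H) := by
  classical
  rw [stepMean_numDegree hm (k + 1) H (h.le_card_eligibleVertices hd), Finset.sum_sub_distrib,
    sum_eligibleVertices_boole hkd, if_neg (by omega), zero_add]
  simp only [Nat.add_right_cancel_iff]
  rw [sum_eligibleVertices_boole (by omega : k < d)]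

end Reachable

section History

variable {Ω : Type*} (m : ℕ) (G : (n : ℕ) → Ω → SimpleGraph (Fin n))

/-- The graphs `G m, …, G n`. -/
def history (n : ℕ) (ω : Ω) : (i : Finset.Icc m n) → SimpleGraph (Fin i) := fun i => G i ω

/-- `f` is determined by the graphs `G m, …, G n`. -/
def HistoryDetermined {α : Sort*} (n : ℕ) (f : Ω → α) : Prop := f.FactorsThrough (history m G n)

variable {m G}

theorem history_eq_iff {n : ℕ} {ω ω' : Ω} :
    history m G n ω = history m G n ω' ↔ ∀ i ∈ Finset.Icc m n, G i ω = G i ω' := by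
  simp only [history, funext_iff, Subtype.forall]

theorem HistoryDetermined.mono {α : Sort*} {n n' : ℕ} (hn : n ≤ n') {f : Ω → α}
    (hf : HistoryDetermined m G n f) : HistoryDetermined m G n' f := fun _ _ h =>
  hf (history_eq_iff.2 fun i hi => history_eq_iff.1 h i
    (Finset.Icc_subset_Icc le_rfl hn hi))

theorem historyDetermined_graph {n : ℕ} (hn : m ≤ n) : HistoryDetermined m G n (G n) :=
  fun _ _ h => history_eq_iff.1 h n (Finset.mem_Icc.2 ⟨hn, le_rfl⟩)

theorem HistoryDetermined.comp {α β : Sort*} {n : ℕ} {f : Ω → α} (g : α → β)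
    (hf : HistoryDetermined m G n f) : HistoryDetermined m G n (fun ω => g (f ω)) :=
  fun _ _ h => congrArg g (hf h)

theorem HistoryDetermined.comp₂ {α β γ : Sort*} {n : ℕ} {f : Ω → α} {f' : Ω → β} (g : α → β → γ)
    (hf : HistoryDetermined m G n f) (hf' : HistoryDetermined m G n f') :
    HistoryDetermined m G n (fun ω => g (f ω) (f' ω)) :=
  fun _ _ h => congrArg₂ g (hf h) (hf' h)

theorem historyDetermined_sum {n : ℕ} {ι : Type*} (s : Finset ι) {f : ι → Ω → ℝ}
    (hf : ∀ i ∈ s, HistoryDetermined m G n (f i)) :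
    HistoryDetermined m G n (fun ω => ∑ i ∈ s, f i ω) :=
  fun _ _ h => Finset.sum_congr rfl fun i hi => hf i hi h

/-- The event that the history up to time `n` is that of `ω₀` and the next vertex is joined
to `S`. -/
def stepEvent (m : ℕ) (G : (n : ℕ) → Ω → SimpleGraph (Fin n)) (n : ℕ) (ω₀ : Ω)
    (S : Finset (Fin n)) : Set Ω :=
  history m G n ⁻¹' {history m G n ω₀} ∩ {ω | G (n + 1) ω = addVertex (G n ω₀) S}

theorem pairwise_disjoint_stepEvent (n : ℕ) (ω₀ : Ω) :
    Pairwise (Function.onFun Disjoint (stepEvent m G n ω₀)) := by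
  intro S T hST
  refine Set.disjoint_left.2 fun ω h1 h2 => hST (addVertex_injective (G n ω₀) ?_)
  exact h1.2.symm.trans h2.2

end History

namespace IsBoundedUniformAttachment

variable {Ω : Type*} [MeasurableSpace Ω] {μ : Measure Ω} {m d : ℕ}
  {G : (n : ℕ) → Ω → SimpleGraph (Fin n)}

theorem measurableSet_history (hG : IsBoundedUniformAttachment μ m d G) (n : ℕ)
    (x : (i : Finset.Icc m n) → SimpleGraph (Fin i)) :
    MeasurableSet (history m G n ⁻¹' {x}) := by
  have : history m G n ⁻¹' {x} = ⋂ i : Finset.Icc m n, {ω | G i ω = x i} := by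
    ext ω
    simp [history, funext_iff]
  rw [this]
  exact MeasurableSet.iInter fun i => hG.measurableSet_eq i (Finset.mem_Icc.1 i.2).1 _

theorem measurable (hG : IsBoundedUniformAttachment μ m d G) {n : ℕ} {f : Ω → ℝ}
    (hf : HistoryDetermined m G n f) : Measurable f := by
  obtain ⟨F, rfl⟩ := (Function.factorsThrough_iff f).1 hf
  let _ : MeasurableSpace ((i : Finset.Icc m n) → SimpleGraph (Fin i)) := ⊤
  have h1 : Measurable (history m G n) :=
    measurable_to_countable' fun x => hG.measurableSet_history n x
  exact (measurable_from_top (f := F)).comp h1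

theorem integrable [IsFiniteMeasure μ] (hG : IsBoundedUniformAttachment μ m d G) {n : ℕ}
    {f : Ω → ℝ} (hf : HistoryDetermined m G n f) : Integrable f μ := by
  have hmeas := hG.measurable hf
  obtain ⟨F, rfl⟩ := (Function.factorsThrough_iff f).1 hf
  obtain ⟨C, hC⟩ := (Set.finite_range (fun x => ‖F x‖)).bddAbove
  exact Integrable.of_bound hmeas.aestronglyMeasurable C
    (ae_of_all _ fun ω => hC ⟨_, rfl⟩)

theorem measurableSet_stepEvent (hG : IsBoundedUniformAttachment μ m d G) {n : ℕ} (hn : m ≤ n)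
    (ω₀ : Ω) (S : Finset (Fin n)) : MeasurableSet (stepEvent m G n ω₀ S) :=
  (hG.measurableSet_history n _).inter (hG.measurableSet_eq _ (by omega) _)

theorem measureReal_stepEvent (hG : IsBoundedUniformAttachment μ m d G) {n : ℕ} (hn : m ≤ n)
    (ω₀ : Ω) {S : Finset (Fin n)} (hS : S ∈ (eligibleVertices d (G n ω₀)).powersetCard m) :
    μ.real (stepEvent m G n ω₀ S) = μ.real (history m G n ⁻¹' {history m G n ω₀}) *
      (1 / ((eligibleVertices d (G n ω₀)).card.choose m : ℝ)) := by
  have h := hG.step n hn (fun i => G i ω₀) S hS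
  simp only [← history_eq_iff] at h
  exact h

theorem iUnion_stepEvent_ae_eq [IsProbabilityMeasure μ]
    (hG : IsBoundedUniformAttachment μ m d G) {n : ℕ} (hn : m ≤ n) (ω₀ : Ω)
    (hE : m ≤ (eligibleVertices d (G n ω₀)).card) :
    (⋃ S ∈ (eligibleVertices d (G n ω₀)).powersetCard m, stepEvent m G n ω₀ S) =ᵐ[μ]
      history m G n ⁻¹' {history m G n ω₀} := by
  have hC : (0 : ℝ) < (eligibleVertices d (G n ω₀)).card.choose m := by
    exact_mod_cast Nat.choose_pos hE
  refine ae_eq_of_subset_of_measure_ge (Set.iUnion₂_subset fun S _ => Set.inter_subset_left) ?_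
    (Finset.measurableSet_biUnion _ fun S _ =>
      hG.measurableSet_stepEvent hn ω₀ S).nullMeasurableSet (measure_ne_top _ _)
  rw [← ENNReal.toReal_le_toReal (measure_ne_top _ _) (measure_ne_top _ _)]
  change μ.real _ ≤ μ.real _
  rw [measureReal_biUnion_finset (fun S _ T _ h => pairwise_disjoint_stepEvent n ω₀ h)
    (fun S _ => hG.measurableSet_stepEvent hn ω₀ S),
    Finset.sum_congr rfl fun S hS => hG.measureReal_stepEvent hn ω₀ hS, Finset.sum_const,
    Finset.card_powersetCard, nsmul_eq_mul]
  field_simp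
  exact le_rfl

/-- Given the history, the next graph is almost surely obtained by adding a vertex. -/
theorem ae_step [IsProbabilityMeasure μ] (hG : IsBoundedUniformAttachment μ m d G) {n : ℕ}
    (hn : m ≤ n) (hE : ∀ᵐ ω ∂μ, m ≤ (eligibleVertices d (G n ω)).card) :
    ∀ᵐ ω ∂μ, ∃ S ∈ (eligibleVertices d (G n ω)).powersetCard m,
      G (n + 1) ω = addVertex (G n ω) S := by
  have key : ∀ x, ∀ᵐ ω ∂μ, history m G n ω = x → m ≤ (eligibleVertices d (G n ω)).card →
      ∃ S ∈ (eligibleVertices d (G n ω)).powersetCard m, G (n + 1) ω = addVertex (G n ω) S := by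
    intro x
    by_cases hx : ∃ ω₀, history m G n ω₀ = x ∧ m ≤ (eligibleVertices d (G n ω₀)).card
    · obtain ⟨ω₀, rfl, h0⟩ := hx
      filter_upwards [(hG.iUnion_stepEvent_ae_eq hn ω₀ h0).mem_iff] with ω hω h1 _
      have h2 := hω.2 h1
      simp only [Set.mem_iUnion, exists_prop] at h2
      obtain ⟨S, hS, hS'⟩ := h2
      rw [historyDetermined_graph hn h1]
      exact ⟨S, hS, hS'.2⟩
    · exact ae_of_all _ fun ω h1 h2 => absurd ⟨ω, h1, h2⟩ hx
  filter_upwards [hE, ae_all_iff.2 key] with ω h1 h2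
  exact h2 _ rfl h1

theorem setIntegral_next [IsProbabilityMeasure μ] (hG : IsBoundedUniformAttachment μ m d G)
    {n : ℕ} (hn : m ≤ n) (ω₀ : Ω) (hE : m ≤ (eligibleVertices d (G n ω₀)).card)
    (ψ : SimpleGraph (Fin (n + 1)) → ℝ) :
    ∫ ω in history m G n ⁻¹' {history m G n ω₀}, ψ (G (n + 1) ω) ∂μ =
      μ.real (history m G n ⁻¹' {history m G n ω₀}) * stepMean m d ψ (G n ω₀) := by
  have hint : Integrable (fun ω => ψ (G (n + 1) ω)) μ :=
    hG.integrable ((historyDetermined_graph (by omega : m ≤ n + 1)).comp ψ)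
  rw [← setIntegral_congr_set (hG.iUnion_stepEvent_ae_eq hn ω₀ hE),
    integral_biUnion_finset _ (fun S _ => hG.measurableSet_stepEvent hn ω₀ S)
    (fun S _ T _ h => pairwise_disjoint_stepEvent n ω₀ h) (fun S _ => hint.integrableOn), stepMean,
    mul_div_assoc', Finset.mul_sum, Finset.sum_div]
  refine Finset.sum_congr rfl fun S hS => ?_
  rw [setIntegral_congr_fun (g := fun _ => ψ (addVertex (G n ω₀) S))
    (hG.measurableSet_stepEvent hn ω₀ S) (fun ω hω => congrArg ψ hω.2), setIntegral_const,
    hG.measureReal_stepEvent hn ω₀ hS, smul_eq_mul]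
  ring

/-- The conditional mean of a function of the next graph, given the history. -/
theorem integral_mul_next [IsProbabilityMeasure μ] (hG : IsBoundedUniformAttachment μ m d G)
    {n : ℕ} (hn : m ≤ n) (hE : ∀ᵐ ω ∂μ, m ≤ (eligibleVertices d (G n ω)).card)
    {f : Ω → ℝ} (hf : HistoryDetermined m G n f) (ψ : SimpleGraph (Fin (n + 1)) → ℝ) :
    ∫ ω, f ω * ψ (G (n + 1) ω) ∂μ = ∫ ω, f ω * stepMean m d ψ (G n ω) ∂μ := by
  classical
  have := Fintype.ofFinite ((i : Finset.Icc m n) → SimpleGraph (Fin i))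
  have hU : ⋃ x, history m G n ⁻¹' {x} = Set.univ := by ext; simp
  have hdisj : Pairwise (Function.onFun Disjoint fun x => history m G n ⁻¹' {x}) :=
    fun x y h => Set.disjoint_left.2 fun ω h1 h2 => h (h1.symm.trans h2)
  have hi1 : Integrable (fun ω => f ω * ψ (G (n + 1) ω)) μ := hG.integrable
    ((hf.mono n.le_succ).comp₂ (· * ·) ((historyDetermined_graph (by omega)).comp ψ))
  have hi2 : Integrable (fun ω => f ω * stepMean m d ψ (G n ω)) μ := hG.integrable
    (hf.comp₂ (· * ·) ((historyDetermined_graph hn).comp (stepMean m d ψ)))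
  rw [← setIntegral_univ, ← hU, ← setIntegral_univ (f := fun ω => f ω * stepMean m d ψ (G n ω)),
    ← hU, integral_iUnion_fintype (hG.measurableSet_history n) hdisj fun _ => hi1.integrableOn,
    integral_iUnion_fintype (hG.measurableSet_history n) hdisj fun _ => hi2.integrableOn]
  refine Finset.sum_congr rfl fun x _ => ?_
  by_cases hx : ∃ ω₀, history m G n ω₀ = x ∧ m ≤ (eligibleVertices d (G n ω₀)).card
  · obtain ⟨ω₀, rfl, h0⟩ := hx
    have hmeas := hG.measurableSet_history n (history m G n ω₀)
    rw [setIntegral_congr_fun (g := fun ω => f ω₀ * ψ (G (n + 1) ω)) hmeas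
      (fun ω hω => by simp only [hf hω]), integral_const_mul, hG.setIntegral_next hn ω₀ h0,
      setIntegral_congr_fun (g := fun _ => f ω₀ * stepMean m d ψ (G n ω₀)) hmeas
      (fun ω hω => by simp only [hf hω, historyDetermined_graph hn hω]), setIntegral_const,
      smul_eq_mul]
    ring
  · have : μ (history m G n ⁻¹' {x}) = 0 := by
      refine measure_eq_zero_iff_ae_notMem.2 ?_
      filter_upwards [hE] with ω hω h
      exact hx ⟨ω, h, hω⟩
    simp [Measure.restrict_eq_zero.2 this]

theorem ae_reachable [IsProbabilityMeasure μ] (hd : 2 * m < d)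
    (hG : IsBoundedUniformAttachment μ m d G) :
    ∀ᵐ ω ∂μ, ∀ n, m ≤ n → Reachable m d n (G n ω) := by
  rw [ae_all_iff]
  intro n
  by_cases hn : m ≤ n
  swap
  · exact ae_of_all _ fun ω h => absurd h hn
  induction n, hn using Nat.le_induction with
  | base =>
    filter_upwards [hG.initial] with ω hω _
    rw [hω]
    exact Reachable.base
  | succ n hn ih =>
    have h1 := hG.ae_step hn (by
      filter_upwards [ih] with ω hω using (hω hn).le_card_eligibleVertices hd)
    filter_upwards [ih, h1] with ω hω h2 _
    obtain ⟨S, hS, h3⟩ := h2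
    rw [h3]
    exact (hω hn).step hS

theorem ae_step_all [IsProbabilityMeasure μ] (hd : 2 * m < d)
    (hG : IsBoundedUniformAttachment μ m d G) {n : ℕ} (hn : m ≤ n) :
    ∀ᵐ ω ∂μ, m ≤ (eligibleVertices d (G n ω)).card ∧
      ∃ S ∈ (eligibleVertices d (G n ω)).powersetCard m, G (n + 1) ω = addVertex (G n ω) S := by
  have h1 : ∀ᵐ ω ∂μ, m ≤ (eligibleVertices d (G n ω)).card := by
    filter_upwards [hG.ae_reachable hd] with ω hω using (hω n hn).le_card_eligibleVertices hd
  filter_upwards [h1, hG.ae_step hn h1] with ω h2 h3 using ⟨h2, h3⟩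

end IsBoundedUniformAttachment

/-- The process `φ (G n)` minus its compensator. -/
noncomputable def compensated {Ω : Type*} (m d : ℕ) (G : (n : ℕ) → Ω → SimpleGraph (Fin n))
    (φ : (n : ℕ) → SimpleGraph (Fin n) → ℝ) (n : ℕ) (ω : Ω) : ℝ :=
  φ n (G n ω) - ∑ s ∈ Finset.Ico m n, (stepMean m d (φ (s + 1)) (G s ω) - φ s (G s ω))

theorem compensated_succ {Ω : Type*} {m d : ℕ} (G : (n : ℕ) → Ω → SimpleGraph (Fin n))
    (φ : (n : ℕ) → SimpleGraph (Fin n) → ℝ) {n : ℕ} (hn : m ≤ n) (ω : Ω) :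
    compensated m d G φ (n + 1) ω = compensated m d G φ n ω +
      (φ (n + 1) (G (n + 1) ω) - stepMean m d (φ (n + 1)) (G n ω)) := by
  rw [compensated, compensated, Finset.sum_Ico_succ_top hn]
  ring

theorem historyDetermined_compensated {Ω : Type*} {m d : ℕ}
    (G : (n : ℕ) → Ω → SimpleGraph (Fin n)) (φ : (n : ℕ) → SimpleGraph (Fin n) → ℝ) {n : ℕ}
    (hn : m ≤ n) : HistoryDetermined m G n (compensated m d G φ n) := by
  refine ((historyDetermined_graph hn).comp (φ n)).comp₂ (· - ·)
    (historyDetermined_sum _ fun s hs => ?_)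
  rw [Finset.mem_Ico] at hs
  exact ((historyDetermined_graph hs.1).comp
    (fun H => stepMean m d (φ (s + 1)) H - φ s H)).mono hs.2.le

theorem summable_exp_neg_rpow {δ : ℝ} (hδ : 0 < δ) :
    Summable fun n : ℕ => Real.exp (-(n : ℝ) ^ δ) := by
  have h1 := (isLittleO_exp_neg_mul_rpow_atTop one_pos (-2 / δ)).comp_tendsto
    ((tendsto_rpow_atTop hδ).comp tendsto_natCast_atTop_atTop)
  refine summable_of_isBigO_nat (Real.summable_nat_rpow.2 (by norm_num : (-2 : ℝ) < -1)) ?_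
  refine h1.isBigO.congr (fun n => by simp) fun n => ?_
  simp only [Function.comp]
  rw [← Real.rpow_mul n.cast_nonneg]
  congr 1
  field_simp

namespace IsBoundedUniformAttachment

variable {Ω : Type*} [MeasurableSpace Ω] {μ : Measure Ω} [IsProbabilityMeasure μ] {m d : ℕ}
  {G : (n : ℕ) → Ω → SimpleGraph (Fin n)}

theorem abs_compensated_step_le (hd : 2 * m < d)
    (hG : IsBoundedUniformAttachment μ m d G) (φ : (n : ℕ) → SimpleGraph (Fin n) → ℝ) {c : ℝ}
    (hφ : ∀ n (H : SimpleGraph (Fin n)), ∀ S ∈ (eligibleVertices d H).powersetCard m,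
      |φ (n + 1) (addVertex H S) - φ n H| ≤ c) {n : ℕ} (hn : m ≤ n) :
    ∀ᵐ ω ∂μ, |φ (n + 1) (G (n + 1) ω) - stepMean m d (φ (n + 1)) (G n ω)| ≤ 2 * c := by
  filter_upwards [hG.ae_step_all hd hn] with ω hω
  obtain ⟨h1, S, hS, h2⟩ := hω
  have h3 := abs_stepMean_sub_le (φ (n + 1)) (G n ω) h1 (φ n (G n ω)) c (hφ n (G n ω))
  have h4 := hφ n (G n ω) S hS
  rw [h2]
  rw [abs_le] at *
  constructor <;> linarith

theorem integral_exp_compensated_le (hd : 2 * m < d)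
    (hG : IsBoundedUniformAttachment μ m d G) (φ : (n : ℕ) → SimpleGraph (Fin n) → ℝ) {c : ℝ}
    (hφ : ∀ n (H : SimpleGraph (Fin n)), ∀ S ∈ (eligibleVertices d H).powersetCard m,
      |φ (n + 1) (addVertex H S) - φ n H| ≤ c) {s : ℝ} (hs : |s| * (2 * c) ≤ 1)
    {n : ℕ} (hn : m ≤ n) :
    ∫ ω, Real.exp (s * compensated m d G φ n ω) ∂μ ≤
      Real.exp (|s| * |φ m ⊤|) * (1 + (s * (2 * c)) ^ 2) ^ (n - m) := by
  induction n, hn using Nat.le_induction with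
  | base =>
    have : ∀ᵐ ω ∂μ, Real.exp (s * compensated m d G φ m ω) = Real.exp (s * φ m ⊤) := by
      filter_upwards [hG.initial] with ω hω
      simp [compensated, hω]
    rw [integral_congr_ae this]
    simp only [integral_const, probReal_univ, one_smul, Nat.sub_self, pow_zero, mul_one]
    rw [Real.exp_le_exp, ← abs_mul]
    exact le_abs_self _
  | succ n hn ih =>
    have hM := historyDetermined_compensated (d := d) G φ hn
    have hM' := historyDetermined_compensated (d := d) G φ (hn.trans n.le_succ)
    have hexp := hM.comp (fun x => Real.exp (s * x))
    have hnext := (historyDetermined_graph (G := G) (hn.trans n.le_succ)).comp (φ (n + 1))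
    have hmean := (historyDetermined_graph (G := G) hn).comp (stepMean m d (φ (n + 1)))
    have hzero : ∫ ω, Real.exp (s * compensated m d G φ n ω) *
        (φ (n + 1) (G (n + 1) ω) - stepMean m d (φ (n + 1)) (G n ω)) ∂μ = 0 := by
      simp only [mul_sub]
      rw [integral_sub, hG.integral_mul_next hn ?_ hexp (φ (n + 1)), sub_self]
      · filter_upwards [hG.ae_step_all hd hn] with ω hω using hω.1
      · exact hG.integrable ((hexp.mono n.le_succ).comp₂ (· * ·) hnext)
      · exact hG.integrable (hexp.comp₂ (· * ·) hmean)
    have hle : ∀ᵐ ω ∂μ, Real.exp (s * compensated m d G φ (n + 1) ω) ≤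
        (1 + (s * (2 * c)) ^ 2) * Real.exp (s * compensated m d G φ n ω) +
        s * (Real.exp (s * compensated m d G φ n ω) *
          (φ (n + 1) (G (n + 1) ω) - stepMean m d (φ (n + 1)) (G n ω))) := by
      filter_upwards [hG.abs_compensated_step_le hd φ hφ hn] with ω hω
      rw [compensated_succ G φ hn]
      generalize φ (n + 1) (G (n + 1) ω) - stepMean m d (φ (n + 1)) (G n ω) = ξ at *
      have h1 : |s * ξ| ≤ |s| * (2 * c) := by rw [abs_mul]; gcongr
      have h2 := (abs_le.1 (Real.abs_exp_sub_one_sub_id_le (h1.trans hs))).2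
      have h3 : (s * ξ) ^ 2 ≤ (s * (2 * c)) ^ 2 := by
        have : (s * (2 * c)) ^ 2 = (|s| * (2 * c)) ^ 2 := by
          rw [mul_pow, mul_pow |s|, sq_abs]
        rw [this]
        exact sq_le_sq' (by linarith [(abs_le.1 h1).1]) (abs_le.1 h1).2
      rw [mul_add, Real.exp_add]
      have h4 := mul_le_mul_of_nonneg_left
        (show Real.exp (s * ξ) ≤ 1 + (s * (2 * c)) ^ 2 + s * ξ by linarith)
        (Real.exp_pos (s * compensated m d G φ n ω)).le
      linarith
    have hi1 := hG.integrable hexp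
    have hi2 : Integrable (fun ω => Real.exp (s * compensated m d G φ n ω) *
        (φ (n + 1) (G (n + 1) ω) - stepMean m d (φ (n + 1)) (G n ω))) μ :=
      hG.integrable ((hexp.mono n.le_succ).comp₂ (· * ·)
        (hnext.comp₂ (· - ·) (hmean.mono n.le_succ)))
    refine (integral_mono_ae (hG.integrable (hM'.comp (fun x => Real.exp (s * x))))
      ((hi1.const_mul _).add (hi2.const_mul _)) hle).trans ?_
    simp only [Pi.add_apply]
    rw [integral_add (hi1.const_mul _) (hi2.const_mul _), integral_const_mul, integral_const_mul,
      hzero, mul_zero, add_zero, Nat.succ_sub hn,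
      pow_succ (1 + (s * (2 * c)) ^ 2)]
    have h5 := mul_le_mul_of_nonneg_left ih (by positivity : 0 ≤ 1 + (s * (2 * c)) ^ 2)
    linarith

theorem ae_eventually_abs_compensated_lt (hd : 2 * m < d)
    (hG : IsBoundedUniformAttachment μ m d G) (φ : (n : ℕ) → SimpleGraph (Fin n) → ℝ) {c : ℝ}
    (hc : 0 < c)
    (hφ : ∀ n (H : SimpleGraph (Fin n)), ∀ S ∈ (eligibleVertices d H).powersetCard m,
      |φ (n + 1) (addVertex H S) - φ n H| ≤ c) {δ : ℝ} (hδ : 0 < δ) :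
    ∀ᵐ ω ∂μ, ∀ᶠ n : ℕ in atTop, |compensated m d G φ n ω| < (n : ℝ) ^ (1 / 2 + δ) := by
  set K := Real.exp (|φ m ⊤| + 4 * c ^ 2) with hK
  have key : ∀ n : ℕ, max (m + 1) (⌈4 * c ^ 2⌉₊) ≤ n →
      μ.real {ω | (n : ℝ) ^ (1 / 2 + δ) ≤ |compensated m d G φ n ω|} ≤
        2 * K * Real.exp (-(n : ℝ) ^ δ) := by
    intro n hn
    rw [max_le_iff, Nat.ceil_le] at hn
    have hn0 : (0 : ℝ) < n := by exact_mod_cast (by omega : 0 < n)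
    have hn1 : (1 : ℝ) ≤ n := by exact_mod_cast (by omega : 1 ≤ n)
    have hmn : m ≤ n := by omega
    set t : ℝ := (n : ℝ) ^ (-(1 / 2) : ℝ) with ht
    have ht0 : 0 < t := Real.rpow_pos_of_pos hn0 _
    have ht1 : t ≤ 1 := Real.rpow_le_one_of_one_le_of_nonpos hn1 (by norm_num)
    have ht2 : t ^ 2 * n = 1 := by
      rw [ht, ← Real.rpow_natCast, ← Real.rpow_mul hn0.le]
      norm_num
      rw [Real.rpow_neg_one, inv_mul_cancel₀ hn0.ne']
    have hexp : ∀ s, |s| = t → ∫ ω, Real.exp (s * compensated m d G φ n ω) ∂μ ≤ K := by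
      intro s hs
      have hs2 : s ^ 2 = t ^ 2 := by rw [← sq_abs, hs]
      refine (hG.integral_exp_compensated_le hd φ hφ (s := s) ?_ hmn).trans ?_
      · rw [hs]
        refine (sq_le_sq₀ (by positivity) zero_le_one).1 ?_
        nlinarith [mul_le_mul_of_nonneg_left hn.2 (sq_nonneg t)]
      · rw [hK, Real.exp_add]
        gcongr
        · rw [hs]
          exact mul_le_of_le_one_left (abs_nonneg _) ht1
        · calc (1 + (s * (2 * c)) ^ 2) ^ (n - m)
              ≤ (1 + (s * (2 * c)) ^ 2) ^ n :=
                pow_le_pow_right₀ (by nlinarith [sq_nonneg (s * (2 * c))]) (Nat.sub_le _ _)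
            _ ≤ Real.exp ((s * (2 * c)) ^ 2) ^ n := by
                gcongr
                linarith [Real.add_one_le_exp ((s * (2 * c)) ^ 2)]
            _ = Real.exp (4 * c ^ 2) := by
                rw [← Real.exp_nat_mul]
                congr 1
                rw [mul_pow, hs2]
                linear_combination 4 * c ^ 2 * ht2
    have hint : ∀ s, Integrable (fun ω => Real.exp (s * compensated m d G φ n ω)) μ := fun s =>
      hG.integrable ((historyDetermined_compensated G φ hmn).comp (fun x => Real.exp (s * x)))
    have htn : t * (n : ℝ) ^ (1 / 2 + δ) = (n : ℝ) ^ δ := by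
      rw [ht, ← Real.rpow_add hn0]
      congr 1
      ring
    have h1 := ProbabilityTheory.measure_ge_le_exp_mul_mgf ((n : ℝ) ^ (1 / 2 + δ)) ht0.le (hint t)
    have h2 := ProbabilityTheory.measure_le_le_exp_mul_mgf (-(n : ℝ) ^ (1 / 2 + δ))
      (neg_nonpos.2 ht0.le) (hint (-t))
    have h3 : {ω | (n : ℝ) ^ (1 / 2 + δ) ≤ |compensated m d G φ n ω|} ⊆
        {ω | (n : ℝ) ^ (1 / 2 + δ) ≤ compensated m d G φ n ω} ∪
        {ω | compensated m d G φ n ω ≤ -(n : ℝ) ^ (1 / 2 + δ)} := by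
      intro ω hω
      simp only [Set.mem_ofPred_eq, Set.mem_union, le_abs] at hω ⊢
      exact hω.imp_right le_neg_of_le_neg
    refine (measureReal_mono h3).trans ((measureReal_union_le _ _).trans ?_)
    have h4 : ProbabilityTheory.mgf (compensated m d G φ n) μ t ≤ K :=
      hexp t (abs_of_pos ht0)
    have h5 : ProbabilityTheory.mgf (compensated m d G φ n) μ (-t) ≤ K :=
      hexp (-t) (by rw [abs_neg, abs_of_pos ht0])
    rw [neg_neg, mul_neg, htn] at h2
    rw [neg_mul, htn] at h1
    have h6 := mul_le_mul_of_nonneg_left h4 (Real.exp_pos (-(n : ℝ) ^ δ)).le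
    have h7 := mul_le_mul_of_nonneg_left h5 (Real.exp_pos (-(n : ℝ) ^ δ)).le
    linarith
  have hsum : Summable fun n : ℕ =>
      μ.real {ω | (n : ℝ) ^ (1 / 2 + δ) ≤ |compensated m d G φ n ω|} := by
    refine summable_of_isBigO_nat (summable_exp_neg_rpow hδ) (IsBigO.of_bound (2 * K) ?_)
    filter_upwards [eventually_ge_atTop (max (m + 1) (⌈4 * c ^ 2⌉₊))] with n hn
    rw [Real.norm_of_nonneg measureReal_nonneg, Real.norm_of_nonneg (Real.exp_pos _).le]
    exact key n hn
  have hfin : ∑' n : ℕ, μ {ω | (n : ℝ) ^ (1 / 2 + δ) ≤ |compensated m d G φ n ω|} ≠ ⊤ := by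
    have := hsum.tsum_ofReal_ne_top
    simpa [measureReal_def, ENNReal.ofReal_toReal, measure_ne_top] using this
  filter_upwards [ae_eventually_notMem hfin] with ω hω
  filter_upwards [hω] with n hn
  exact not_le.1 hn

end IsBoundedUniformAttachment

section Recursion

theorem rpow_add_mul_div_le {β : ℝ} (h0 : 0 ≤ β) (h1 : β ≤ 1) (n : ℕ) :
    (n : ℝ) ^ β + β * (((n : ℝ) + 1) ^ β / (n + 1)) ≤ ((n : ℝ) + 1) ^ β := by
  have hn : (0 : ℝ) < n + 1 := by positivity
  have hs : (-1 : ℝ) ≤ -1 / (n + 1) := by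
    rw [le_div_iff₀ hn]
    have : (0 : ℝ) ≤ n := n.cast_nonneg
    linarith
  have h2 := rpow_one_add_le_one_add_mul_self hs h0 h1
  have h3 : (n : ℝ) = (n + 1) * (1 + -1 / (n + 1)) := by field_simp; ring
  have h4 := mul_le_mul_of_nonneg_left h2 (Real.rpow_nonneg hn.le β)
  rw [← Real.mul_rpow hn.le (by linarith), ← h3] at h4
  calc _ ≤ ((n : ℝ) + 1) ^ β * (1 + β * (-1 / (n + 1))) + β * (((n : ℝ) + 1) ^ β / (n + 1)) := by
        gcongr
    _ = _ := by ring

theorem one_sub_mul_sum_sub_mul_pow (t : ℝ) (D : ℕ) :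
    (1 - t) * ∑ i ∈ Finset.range D, ((D : ℝ) - i) * t ^ i =
      D - ∑ i ∈ Finset.range D, t ^ (i + 1) := by
  induction D with
  | zero => simp
  | succ D ih =>
    have h1 : ∑ i ∈ Finset.range (D + 1), (((D + 1 : ℕ) : ℝ) - i) * t ^ i =
        ∑ i ∈ Finset.range D, ((D : ℝ) - i) * t ^ i + ∑ i ∈ Finset.range (D + 1), t ^ i := by
      rw [Finset.sum_range_succ, Finset.sum_range_succ _ D, ← add_assoc,
        ← Finset.sum_add_distrib]
      congr 1
      · exact Finset.sum_congr rfl fun i _ => by push_cast; ring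
      · push_cast; ring
    rw [h1, mul_add, ih, mul_neg_geom_sum, Finset.sum_range_succ]
    push_cast
    ring

variable {D : ℕ} {m x w : ℝ}

theorem sum_inv_pow_succ (hw : 1 < w) (hwx : m * w = m + 1 - x) (hx : x * w ^ D = 1) :
    ∑ i ∈ Finset.range D, w⁻¹ ^ (i + 1) = m := by
  have hw0 : w ≠ 0 := by positivity
  have h1 := mul_neg_geom_sum w⁻¹ D
  have h2 : w⁻¹ ^ D = x := by rw [inv_pow, ← eq_inv_of_mul_eq_one_left hx]
  have h3 : w - 1 ≠ 0 := by linarith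
  simp only [pow_succ', ← Finset.mul_sum]
  rw [h2] at h1
  have h4 : (1 - w⁻¹) = (w - 1) * w⁻¹ := by field_simp
  refine mul_left_cancel₀ h3 ?_
  rw [← mul_assoc, ← h4, h1]
  linear_combination -hwx

theorem sum_inv_pow_sub (hw : 1 < w) (hwx : m * w = m + 1 - x) (hx : x * w ^ D = 1) :
    ∑ i ∈ Finset.range D, w⁻¹ ^ (D - i) = m := by
  rw [← sum_inv_pow_succ hw hwx hx, ← Finset.sum_range_reflect]
  refine Finset.sum_congr rfl fun i hi => ?_
  congr 1
  have := Finset.mem_range.1 hi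
  omega

theorem sum_inv_pow_sub_mul (hw : w ≠ 0) (u : ℕ → ℝ) :
    ∑ i ∈ Finset.range D, w⁻¹ ^ (D - i) * (u i - w * u (i + 1)) = w⁻¹ ^ D * u 0 - u D := by
  have := Finset.sum_range_sub' (fun i => w⁻¹ ^ (D - i) * u i) D
  simp only [Nat.sub_zero, Nat.sub_self, pow_zero, one_mul] at this
  rw [← this]
  refine Finset.sum_congr rfl fun i hi => ?_
  have h : D - i = (D - (i + 1)) + 1 := by
    have := Finset.mem_range.1 hi
    omega
  rw [h, pow_succ]
  field_simp

/-- In the chain `v 0 → v 1 → ⋯ → v D` with inflow `v 0 = (v 1 + ⋯ + v D) / m`, perturbed by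
noise with partial sums `W`, the deviations `v i - w * v (i + 1)` from the geometric profile are of
the order of `W`. -/
theorem exists_abs_sub_mul_le (hD : 0 < D) (hm : 0 < m) (hw : 1 < w) (hwx : m * w = m + 1 - x)
    (hx : x * w ^ D = 1) {β C Λ : ℝ} (hβ0 : 0 < β) (hβ1 : β ≤ 1) (hΛ : 0 ≤ Λ) (hC : 0 ≤ C)
    {n₀ : ℕ} (hn₀ : 1 ≤ n₀) {a : ℕ → ℝ} {v W : ℕ → ℕ → ℝ}
    (ha0 : ∀ n, n₀ ≤ n → 0 ≤ a n) (ha1 : ∀ n, n₀ ≤ n → a n ≤ 1)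
    (haC : ∀ n, n₀ ≤ n → a n ≤ C / (n + 1))
    (hv0 : ∀ n, n₀ ≤ n → m * v 0 n = ∑ i ∈ Finset.range D, v (i + 1) n)
    (hW0 : ∀ n, n₀ ≤ n → m * W 0 n = ∑ i ∈ Finset.range D, W (i + 1) n)
    (hW : ∀ n, n₀ ≤ n → ∀ i ≤ D, |W i n| ≤ Λ * (n : ℝ) ^ β)
    (hv : ∀ n, n₀ ≤ n → ∀ i < D, v (i + 1) (n + 1) =
      v (i + 1) n + a n * (v i n - v (i + 1) n) + (W (i + 1) (n + 1) - W (i + 1) n)) :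
    ∃ K, 0 ≤ K ∧ ∀ n, n₀ ≤ n → ∀ i < D, |v i n - w * v (i + 1) n| ≤ K * (n : ℝ) ^ β := by
  have hw0 : w ≠ 0 := by positivity
  set L : ℕ → ℕ → ℝ := fun i n => W i n - w * W (i + 1) n with hL
  set z : ℕ → ℕ → ℝ := fun i n => (v i n - w * v (i + 1) n) - L i n with hz
  set Λ' := (1 + w) * Λ with hΛ'
  have hΛ'0 : 0 ≤ Λ' := by positivity
  have hLb : ∀ n, n₀ ≤ n → ∀ i < D, |L i n| ≤ Λ' * (n : ℝ) ^ β := by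
    intro n hn i hi
    calc |L i n| ≤ |W i n| + |w * W (i + 1) n| := abs_sub _ _
      _ ≤ Λ * (n : ℝ) ^ β + w * (Λ * (n : ℝ) ^ β) := by
        rw [abs_mul, abs_of_pos (by linarith : 0 < w)]
        gcongr
        · exact hW n hn i hi.le
        · exact hW n hn (i + 1) hi
      _ = _ := by rw [hΛ']; ring
  have hz_succ : ∀ n, n₀ ≤ n → ∀ i, i + 1 < D → z (i + 1) (n + 1) =
      (1 - a n) * z (i + 1) n + a n * (z i n + (L i n - L (i + 1) n)) := by
    intro n hn i hi
    simp only [hz, hL]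
    rw [hv n hn i (by omega), hv n hn (i + 1) hi]
    ring
  have hv0' : ∀ n, n₀ ≤ n → m * v 0 (n + 1) = m * v 0 n +
      a n * (∑ i ∈ Finset.range D, v i n - m * v 0 n) + (m * W 0 (n + 1) - m * W 0 n) := by
    intro n hn
    rw [hv0 (n + 1) (by omega), hv0 n hn, hW0 n hn, hW0 (n + 1) (by omega),
      Finset.sum_congr rfl fun i hi => hv n hn i (Finset.mem_range.1 hi)]
    simp only [Finset.sum_add_distrib, Finset.sum_sub_distrib, ← Finset.mul_sum]
  have hconv : ∀ n, n₀ ≤ n → ∑ i ∈ Finset.range D, v i n - m * w * v 0 n =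
      ∑ i ∈ Finset.range D, w⁻¹ ^ (D - i) * (v i n - w * v (i + 1) n) := by
    intro n hn
    rw [sum_inv_pow_sub_mul hw0 (fun i => v i n), hwx, inv_pow, ← eq_inv_of_mul_eq_one_left hx]
    have h1 := Finset.sum_range_succ (fun i => v i n) D
    rw [Finset.sum_range_succ' (fun i => v i n), ← hv0 n hn] at h1
    linarith
  have hz_zero : ∀ n, n₀ ≤ n → z 0 (n + 1) = (1 - a n) * z 0 n + a n *
      ((∑ i ∈ Finset.range D, w⁻¹ ^ (D - i) * (z i n + (L i n - L 0 n))) / m) := by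
    intro n hn
    have h1 : ∑ i ∈ Finset.range D, w⁻¹ ^ (D - i) * (z i n + (L i n - L 0 n)) =
        ∑ i ∈ Finset.range D, w⁻¹ ^ (D - i) * (v i n - w * v (i + 1) n) - m * L 0 n := by
      rw [← sum_inv_pow_sub hw hwx hx, Finset.sum_mul, ← Finset.sum_sub_distrib]
      refine Finset.sum_congr rfl fun i _ => ?_
      simp only [hz]
      ring
    rw [h1, ← hconv n hn]
    have h2 := hv0' n hn
    have h3 := hv n hn 0 hD
    refine mul_left_cancel₀ hm.ne' ?_
    have h4 : m * (a n * ((∑ i ∈ Finset.range D, v i n - m * w * v 0 n - m * L 0 n) / m)) =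
        a n * (∑ i ∈ Finset.range D, v i n - m * w * v 0 n - m * L 0 n) := by field_simp
    rw [mul_add, h4]
    simp only [hz, hL] at *
    linear_combination h2 - m * w * h3
  set K := ∑ i ∈ Finset.range D, |z i n₀| + 2 * C * Λ' / β with hK
  have hS0 : 0 ≤ ∑ i ∈ Finset.range D, |z i n₀| := Finset.sum_nonneg fun _ _ => abs_nonneg _
  have hK0 : 0 ≤ K := by positivity
  have hmain : ∀ n, n₀ ≤ n → ∀ i < D, |z i n| ≤ K * (n : ℝ) ^ β := by
    intro n hn
    induction n, hn using Nat.le_induction with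
    | base =>
      intro i hi
      have h1 : (1 : ℝ) ≤ (n₀ : ℝ) ^ β := Real.one_le_rpow (by exact_mod_cast hn₀) hβ0.le
      have h2 : |z i n₀| ≤ K :=
        (Finset.single_le_sum (f := fun i => |z i n₀|) (fun _ _ => abs_nonneg _)
          (Finset.mem_range.2 hi)).trans (le_add_of_nonneg_right (by positivity))
      exact h2.trans (le_mul_of_one_le_right hK0 h1)
    | succ n hn ih =>
      have hgrow : K * (n : ℝ) ^ β + a n * (2 * (Λ' * (n : ℝ) ^ β)) ≤ K * ((n : ℝ) + 1) ^ β := by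
        have h1 := mul_le_mul_of_nonneg_left (rpow_add_mul_div_le hβ0.le hβ1 n) hK0
        have h2 : (n : ℝ) ^ β ≤ ((n : ℝ) + 1) ^ β := by gcongr; linarith
        have h3 : a n * (2 * (Λ' * (n : ℝ) ^ β)) ≤
            C / (n + 1) * (2 * (Λ' * ((n : ℝ) + 1) ^ β)) := by
          gcongr
          exact haC n hn
        have h4 : 2 * C * Λ' ≤ K * β := by
          have : 2 * C * Λ' / β * β = 2 * C * Λ' := by field_simp
          rw [hK, add_mul, this]
          have := mul_nonneg hS0 hβ0.le
          linarith
        have h5 := mul_le_mul_of_nonneg_right h4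
          (by positivity : 0 ≤ ((n : ℝ) + 1) ^ β / (n + 1))
        calc _ ≤ K * (n : ℝ) ^ β + C / (n + 1) * (2 * (Λ' * ((n : ℝ) + 1) ^ β)) := by linarith
          _ = K * (n : ℝ) ^ β + 2 * C * Λ' * (((n : ℝ) + 1) ^ β / (n + 1)) := by ring
          _ ≤ _ := by linarith
      have hcomb : ∀ p q : ℝ, |p| ≤ K * (n : ℝ) ^ β →
          |q| ≤ K * (n : ℝ) ^ β + 2 * (Λ' * (n : ℝ) ^ β) →
          |(1 - a n) * p + a n * q| ≤ K * ((n : ℝ) + 1) ^ β := by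
        intro p q hp hq
        refine le_trans ?_ hgrow
        refine (abs_add_le _ _).trans ?_
        rw [abs_mul, abs_mul, abs_of_nonneg (ha0 n hn), abs_of_nonneg (sub_nonneg.2 (ha1 n hn))]
        have h1 := mul_le_mul_of_nonneg_left hp (sub_nonneg.2 (ha1 n hn))
        have h2 := mul_le_mul_of_nonneg_left hq (ha0 n hn)
        linarith
      have hsum : ∀ i < D, ∀ j < D, |z i n + (L i n - L j n)| ≤
          K * (n : ℝ) ^ β + 2 * (Λ' * (n : ℝ) ^ β) := by
        intro i hi j hj
        have h1 := abs_add_le (z i n) (L i n - L j n)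
        have h2 := abs_sub (L i n) (L j n)
        have h3 := ih i hi
        have h4 := hLb n hn i hi
        have h5 := hLb n hn j hj
        linarith
      intro i hi
      push_cast
      obtain _ | i := i
      · rw [hz_zero n hn]
        refine hcomb _ _ (ih 0 hD) ?_
        rw [abs_div, abs_of_pos hm, div_le_iff₀ hm]
        refine (Finset.abs_sum_le_sum_abs _ _).trans ?_
        conv_rhs => rw [← sum_inv_pow_sub hw hwx hx, Finset.mul_sum]
        refine Finset.sum_le_sum fun i hi => ?_
        rw [Finset.mem_range] at hi
        rw [abs_mul, abs_of_pos (by positivity), mul_comm]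
        gcongr
        exact hsum i hi 0 hD
      · rw [hz_succ n hn i hi]
        refine hcomb _ _ (ih (i + 1) hi) ?_
        exact hsum i (by omega) (i + 1) hi
  refine ⟨K + Λ', by positivity, fun n hn i hi => ?_⟩
  have h1 : v i n - w * v (i + 1) n = z i n + L i n := by simp only [hz]; ring
  rw [h1, add_mul]
  exact (abs_add_le _ _).trans (add_le_add (hmain n hn i hi) (hLb n hn i hi))

/-- A nearly geometric profile is determined by its total weight. -/
theorem abs_sub_profile_le (hD : 0 < D) (hw : 1 < w) (hwx : m * w = m + 1 - x)
    (hx : x * w ^ D = 1) {u : ℕ → ℝ} {B N e : ℝ} (hB : 0 ≤ B)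
    (hu : ∀ i < D, |u i - w * u (i + 1)| ≤ B)
    (hsum : ∑ i ∈ Finset.range D, ((D : ℝ) - i) * u (i + 1) = (D - m) * N + e) :
    (∀ i < D, |u (i + 1) - (1 - w⁻¹) * w⁻¹ ^ i * N| ≤ |e| + (D ^ 3 + D) * B) ∧
      |u 0 - (w - 1) * N| ≤ w * (|e| + (D ^ 3 + D) * B) + B := by
  have hw0 : 0 < w := by linarith
  have ht1 : w⁻¹ ≤ 1 := inv_le_one_of_one_le₀ hw.le
  have ht0 : 0 < w⁻¹ := by positivity
  have hgeo : ∀ i < D, |u (i + 1) - w⁻¹ ^ i * u 1| ≤ i * B := by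
    intro i
    induction i with
    | zero => simp
    | succ i ih =>
      intro hi
      have h1 := hu (i + 1) hi
      have h2 := ih (by omega)
      have h3 : u (i + 1 + 1) - w⁻¹ ^ (i + 1) * u 1 =
          w⁻¹ * ((u (i + 1) - w⁻¹ ^ i * u 1) - (u (i + 1) - w * u (i + 1 + 1))) := by
        rw [pow_succ]
        linear_combination -u (i + 1 + 1) * inv_mul_cancel₀ hw0.ne'
      rw [h3, abs_mul, abs_of_pos ht0]
      refine (mul_le_of_le_one_left (abs_nonneg _) ht1).trans ((abs_sub _ _).trans ?_)
      push_cast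
      linarith
  have hgeo' : ∀ i < D, |u (i + 1) - w⁻¹ ^ i * u 1| ≤ D * B := fun i hi =>
    (hgeo i hi).trans (by gcongr)
  set Q := ∑ i ∈ Finset.range D, ((D : ℝ) - i) * w⁻¹ ^ i with hQ
  have hQ1 : (1 - w⁻¹) * Q = D - m := by
    rw [hQ, one_sub_mul_sum_sub_mul_pow, sum_inv_pow_succ hw hwx hx]
  have hQge : 1 ≤ Q := by
    have h1 : ((D : ℝ) - (0 : ℕ)) * w⁻¹ ^ 0 ≤ Q :=
      Finset.single_le_sum (f := fun i : ℕ => ((D : ℝ) - i) * w⁻¹ ^ i) (fun i hi => by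
        have : (i : ℝ) ≤ D := by exact_mod_cast (Finset.mem_range.1 hi).le
        have := sub_nonneg.2 this
        positivity) (Finset.mem_range.2 hD)
    have h2 : (1 : ℝ) ≤ D := by exact_mod_cast hD
    simp at h1
    linarith
  have h1 : |u 1 - (1 - w⁻¹) * N| ≤ |e| + D ^ 3 * B := by
    have h2 : Q * (u 1 - (1 - w⁻¹) * N) =
        e - ∑ i ∈ Finset.range D, ((D : ℝ) - i) * (u (i + 1) - w⁻¹ ^ i * u 1) := by
      simp only [mul_sub, Finset.sum_sub_distrib]
      simp only [hsum, ← mul_assoc, ← Finset.sum_mul, ← hQ]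
      linear_combination -N * hQ1
    have h3 : |∑ i ∈ Finset.range D, ((D : ℝ) - i) * (u (i + 1) - w⁻¹ ^ i * u 1)| ≤
        D ^ 3 * B := by
      refine (Finset.abs_sum_le_sum_abs _ _).trans ?_
      refine (Finset.sum_le_card_nsmul _ _ (D * (D * B)) fun i hi => ?_).trans
        (by rw [Finset.card_range, nsmul_eq_mul]; exact le_of_eq (by ring))
      have hi' : (i : ℝ) ≤ D := by exact_mod_cast (Finset.mem_range.1 hi).le
      rw [abs_mul, abs_of_nonneg (sub_nonneg.2 hi')]
      have := hgeo' i (Finset.mem_range.1 hi)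
      gcongr
      linarith [(Nat.cast_nonneg i : (0 : ℝ) ≤ i)]
    have h4 : |u 1 - (1 - w⁻¹) * N| ≤ |Q * (u 1 - (1 - w⁻¹) * N)| := by
      rw [abs_mul, abs_of_pos (by linarith : 0 < Q)]
      exact le_mul_of_one_le_left (abs_nonneg _) hQge
    rw [h2] at h4
    linarith [abs_sub e (∑ i ∈ Finset.range D, ((D : ℝ) - i) * (u (i + 1) - w⁻¹ ^ i * u 1))]
  constructor
  · intro i hi
    have h2 : u (i + 1) - (1 - w⁻¹) * w⁻¹ ^ i * N =
        (u (i + 1) - w⁻¹ ^ i * u 1) + w⁻¹ ^ i * (u 1 - (1 - w⁻¹) * N) := by ring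
    have h3 : |w⁻¹ ^ i * (u 1 - (1 - w⁻¹) * N)| ≤ |u 1 - (1 - w⁻¹) * N| := by
      rw [abs_mul, abs_of_pos (by positivity)]
      exact mul_le_of_le_one_left (abs_nonneg _) (pow_le_one₀ ht0.le ht1)
    rw [h2]
    linarith [abs_add_le (u (i + 1) - w⁻¹ ^ i * u 1) (w⁻¹ ^ i * (u 1 - (1 - w⁻¹) * N)), hgeo' i hi]
  · have h2 : u 0 - (w - 1) * N = (u 0 - w * u 1) + w * (u 1 - (1 - w⁻¹) * N) := by
      field_simp
      ring
    have h3 : |w * (u 1 - (1 - w⁻¹) * N)| ≤ w * (|e| + (D ^ 3 + D) * B) := by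
      rw [abs_mul, abs_of_pos hw0]
      gcongr
      have : (0 : ℝ) ≤ D * B := by positivity
      linarith
    rw [h2]
    linarith [abs_add_le (u 0 - w * u 1) (w * (u 1 - (1 - w⁻¹) * N)), hu 0 hD]

end Recursion

section Root

variable {m d : ℕ}

theorem two_mul_div_lt_one (hd : 2 * m < d) : (2 * m / d : ℝ) < 1 := by
  rw [div_lt_one (by exact_mod_cast (by omega : 0 < d))]
  exact_mod_cast hd

theorem isTopRoot_iff (hd : 2 * m < d) {x : ℝ} :
    IsTopRoot m d x ↔ x ∈ Set.Ioo (0 : ℝ) (2 * m / d) ∧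
      x * ((m : ℝ) + 1 - x) ^ (d - m) = (m : ℝ) ^ (d - m) := by
  refine and_congr_right fun hx => ?_
  have h1 : (0 : ℝ) < m + 1 - x := by
    have := hx.2.trans (two_mul_div_lt_one hd)
    have : (0 : ℝ) ≤ m := m.cast_nonneg
    linarith
  rw [div_pow, div_eq_iff (by positivity), eq_comm]

theorem hasDerivAt_mul_sub_pow (D : ℕ) (c x : ℝ) :
    HasDerivAt (fun x : ℝ => x * (c - x) ^ (D + 1)) ((c - x) ^ D * (c - (D + 2) * x)) x := by
  refine ((hasDerivAt_id' x).mul (((hasDerivAt_id' x).const_sub c).pow (D + 1))).congr_deriv ?_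
  push_cast
  simp only [Pi.pow_apply]
  ring

theorem strictMonoOn_mul_sub_pow (D : ℕ) {c : ℝ} :
    StrictMonoOn (fun x : ℝ => x * (c - x) ^ (D + 1)) (Set.Icc 0 (c / (D + 2))) := by
  refine strictMonoOn_of_deriv_pos (convex_Icc _ _) (by fun_prop) fun x hx => ?_
  rw [interior_Icc] at hx
  rw [(hasDerivAt_mul_sub_pow D c x).deriv]
  have h1 := hx.2
  rw [lt_div_iff₀ (by positivity)] at h1
  have h2 : 0 ≤ (D : ℝ) * x := mul_nonneg D.cast_nonneg hx.1.le
  have h3 := hx.1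
  exact mul_pos (pow_pos (by linarith) D) (by linarith)

theorem strictAntiOn_mul_sub_pow (D : ℕ) {c : ℝ} :
    StrictAntiOn (fun x : ℝ => x * (c - x) ^ (D + 1)) (Set.Icc (c / (D + 2)) c) := by
  refine strictAntiOn_of_deriv_neg (convex_Icc _ _) (by fun_prop) fun x hx => ?_
  rw [interior_Icc] at hx
  rw [(hasDerivAt_mul_sub_pow D c x).deriv]
  have h1 := hx.1
  rw [div_lt_iff₀ (by positivity)] at h1
  have h2 := hx.2
  exact mul_neg_of_pos_of_neg (pow_pos (by linarith) D) (by linarith)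

theorem existsUnique_isTopRoot (hm : 1 ≤ m) (hd : 2 * m < d) : ∃! x : ℝ, IsTopRoot m d x := by
  obtain ⟨D, hD⟩ : ∃ D, d - m = D + 1 := ⟨d - m - 1, by omega⟩
  simp only [isTopRoot_iff hd, hD]
  have hm1 : (1 : ℝ) ≤ m := by exact_mod_cast hm
  have hdm : (d : ℝ) = D + 1 + m := by exact_mod_cast (by omega : d = D + 1 + m)
  have hd' : (2 * m + 1 : ℝ) ≤ d := by exact_mod_cast hd
  have hc : (0 : ℝ) < m + 1 := by positivity
  have hD2 : (0 : ℝ) < D + 2 := by positivity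
  set p : ℝ := (m + 1) / (D + 2) with hp
  have hp0 : 0 < p := by positivity
  have hple : p ≤ 2 * m / d := by
    rw [hp, div_le_div_iff₀ hD2 (by linarith)]
    nlinarith [mul_nonneg (sub_nonneg.2 hm1) (by linarith : (0 : ℝ) ≤ d - 2 * m)]
  have hlt1 := two_mul_div_lt_one hd
  have hmono := strictMonoOn_mul_sub_pow D (c := (m : ℝ) + 1)
  have hanti := strictAntiOn_mul_sub_pow D (c := (m : ℝ) + 1)
  rw [← hp] at hmono hanti
  have habove : ∀ y, p ≤ y → y < 1 → (m : ℝ) ^ (D + 1) < y * ((m : ℝ) + 1 - y) ^ (D + 1) := by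
    intro y h1 h2
    have := hanti ⟨h1, by linarith⟩ ⟨by linarith, by linarith⟩ h2
    simpa using this
  have hcont : ContinuousOn (fun x : ℝ => x * ((m : ℝ) + 1 - x) ^ (D + 1)) (Set.Icc 0 p) := by
    fun_prop
  obtain ⟨x, hx, hfx⟩ := intermediate_value_Ioo hp0.le hcont
    (show (m : ℝ) ^ (D + 1) ∈ Set.Ioo _ _ from
      ⟨by simp; positivity, habove p le_rfl (by linarith)⟩)
  refine ⟨x, ⟨⟨hx.1, hx.2.trans_le hple⟩, hfx⟩, ?_⟩
  rintro y ⟨hy, hfy⟩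
  have hyp : y < p := by
    by_contra! h
    exact (habove y h (hy.2.trans hlt1)).ne' hfy
  exact hmono.injOn ⟨hy.1.le, hyp.le⟩ ⟨hx.1.le, hx.2.le⟩ (hfy.trans hfx.symm)

end Root

/-- Along a path of the process whose compensated degree counts are of order `n ^ β`, all degree
counts are within `O(n ^ β)` of their limiting profile. -/
theorem exists_abs_numDegree_sub_le {Ω : Type*} {m d : ℕ} (hm : 1 ≤ m) (hd : 2 * m < d)
    {G : (n : ℕ) → Ω → SimpleGraph (Fin n)} {ω : Ω} (hreach : ∀ n, m ≤ n → Reachable m d n (G n ω))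
    {x : ℝ} (hx : IsTopRoot m d x) {β : ℝ} (hβ0 : 0 < β) (hβ1 : β ≤ 1)
    (hM : ∀ k, ∀ᶠ n : ℕ in atTop,
      |compensated m d G (fun _ H => (numDegree k H : ℝ)) n ω| ≤ (n : ℝ) ^ β) :
    ∃ K, ∀ᶠ n : ℕ in atTop, ∀ k ∈ Finset.Icc m d,
      |(numDegree k (G n ω) : ℝ) - limitProportion m d x k * n| ≤ K * (n : ℝ) ^ β := by
  have hm0 : (0 : ℝ) < m := by exact_mod_cast hm
  have hm1 : (1 : ℝ) ≤ m := by exact_mod_cast hm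
  have hx1 : x < 1 := hx.1.2.trans (two_mul_div_lt_one hd)
  have hc : (0 : ℝ) < m + 1 - x := by linarith
  obtain ⟨D, hD⟩ : ∃ D, d - m = D := ⟨_, rfl⟩
  have hD0 : 0 < D := by omega
  have hD1 : (1 : ℝ) ≤ D := by exact_mod_cast hD0
  have hdD : (d : ℝ) = D + m := by exact_mod_cast (by omega : d = D + m)
  set w : ℝ := (m + 1 - x) / m with hw
  have hwx : (m : ℝ) * w = m + 1 - x := by rw [hw]; field_simp
  have hw1 : 1 < w := by rw [hw, one_lt_div hm0]; linarith
  have hxw : x * w ^ D = 1 := by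
    have h1 := ((isTopRoot_iff hd).1 hx).2
    rw [hD] at h1
    rw [hw, div_pow, ← mul_div_assoc, h1, div_self (by positivity)]
  have hall : ∀ᶠ n : ℕ in atTop, ∀ i ∈ Finset.range D,
      |compensated m d G (fun _ H => (numDegree (m + i) H : ℝ)) n ω| ≤ (n : ℝ) ^ β :=
    (Finset.eventually_all _).2 fun i _ => hM (m + i)
  obtain ⟨n₁, hn₁⟩ := eventually_atTop.1 hall
  set n₀ := max n₁ (m + 1) with hn₀
  set E : ℕ → ℝ := fun n => ((eligibleVertices d (G n ω)).card : ℝ) with hE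
  set M : ℕ → ℕ → ℝ := fun i n =>
    compensated m d G (fun _ H => (numDegree (m + i) H : ℝ)) n ω with hMdef
  set v : ℕ → ℕ → ℝ := fun i n => match i with
    | 0 => E n / m
    | i + 1 => numDegree (m + i) (G n ω) with hv
  set W : ℕ → ℕ → ℝ := fun i n => match i with
    | 0 => (∑ i ∈ Finset.range D, M i n) / m
    | i + 1 => M i n with hW
  have hmn : ∀ n, n₀ ≤ n → m < n := fun n hn => (le_max_right n₁ (m + 1)).trans hn
  have hEm : ∀ n, n₀ ≤ n → (m : ℝ) ≤ E n := fun n hn =>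
    Nat.cast_le.2 ((hreach n (hmn n hn).le).le_card_eligibleVertices hd)
  have hMb : ∀ n, n₀ ≤ n → ∀ i < D, |M i n| ≤ (n : ℝ) ^ β := fun n hn i hi =>
    hn₁ n ((le_max_left _ _).trans hn) i (Finset.mem_range.2 hi)
  have haC : ∀ n, n₀ ≤ n → m / E n ≤ m * (m + 1) / ((n : ℝ) + 1) := by
    intro n hn
    have h1 : (n : ℝ) + m * (m + 1) ≤ (m + 1) * E n := by
      simp only [hE]
      exact_mod_cast (hreach n (hmn n hn).le).card_le_mul_card_eligibleVertices hd (hmn n hn)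
    have h2 : (n : ℝ) + 1 ≤ (m + 1) * E n := by nlinarith
    rw [div_le_div_iff₀ (hm0.trans_le (hEm n hn)) (by positivity), mul_assoc]
    exact mul_le_mul_of_nonneg_left h2 hm0.le
  have hv0 : ∀ n, n₀ ≤ n → m * v 0 n = ∑ i ∈ Finset.range D, v (i + 1) n := by
    intro n hn
    simp only [hv]
    have h1 := (hreach n (hmn n hn).le).sum_numDegree (hmn n hn)
    rw [hD] at h1
    rw [h1]
    exact mul_div_cancel₀ _ hm0.ne'
  have hW0 : ∀ n, n₀ ≤ n → m * W 0 n = ∑ i ∈ Finset.range D, W (i + 1) n := by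
    intro n hn
    simp only [hW]
    field_simp
  have hWb : ∀ n, n₀ ≤ n → ∀ i ≤ D, |W i n| ≤ D * (n : ℝ) ^ β := by
    intro n hn i hi
    have hpos : 0 ≤ (n : ℝ) ^ β := by positivity
    obtain _ | i := i
    · simp only [hW]
      rw [abs_div, abs_of_pos hm0]
      refine (div_le_self (abs_nonneg _) hm1).trans ((Finset.abs_sum_le_sum_abs _ _).trans ?_)
      refine (Finset.sum_le_card_nsmul _ _ ((n : ℝ) ^ β) fun i hi =>
        hMb n hn i (Finset.mem_range.1 hi)).trans ?_
      simp
    · simp only [hW]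
      exact (hMb n hn i hi).trans (le_mul_of_one_le_left hpos hD1)
  have hvrec : ∀ n, n₀ ≤ n → ∀ i < D, v (i + 1) (n + 1) = v (i + 1) n +
      m / E n * (v i n - v (i + 1) n) + (W (i + 1) (n + 1) - W (i + 1) n) := by
    intro n hn i hi
    have hR := hreach n (hmn n hn).le
    simp only [hW, hMdef]
    rw [compensated_succ G _ (hmn n hn).le]
    obtain _ | i := i
    · have h1 := hR.stepMean_numDegree_bot hm hd (hmn n hn)
      simp only [hv, hE, add_zero] at h1 ⊢
      linear_combination h1
    · have h1 := hR.stepMean_numDegree_succ hm hd (Nat.le_add_right m i) (by omega)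
      simp only [hv, hE, ← add_assoc] at h1 ⊢
      linear_combination h1
  obtain ⟨K, hK0, hK⟩ := exists_abs_sub_mul_le (a := fun n => m / E n) (v := v) (W := W)
    (Λ := D) (C := m * (m + 1)) hD0 hm0 hw1 hwx hxw hβ0 hβ1 (by positivity) (by positivity)
    (n₀ := n₀) ((Nat.le_add_left 1 m).trans (le_max_right _ _)) (fun n _ => by positivity)
    (fun n hn => div_le_one_of_le₀ (hEm n hn) (by positivity)) haC hv0 hW0
    hWb hvrec
  have hlim : ∀ i, m + i < d →
      limitProportion m d x (m + i) = (1 - w⁻¹) * w⁻¹ ^ i := by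
    intro i hi
    rw [limitProportion, if_neg hi.ne, Nat.add_sub_cancel_left, hw, inv_div, div_pow, pow_succ]
    field_simp
    ring
  set K' : ℝ := m * (m + 1) + (D ^ 3 + D) * K with hK'
  have hK'0 : 0 ≤ K' := by positivity
  refine ⟨K' + m * (w * K' + K), ?_⟩
  filter_upwards [eventually_ge_atTop n₀] with n hn k hk
  have hR := hreach n (hmn n hn).le
  have hpow : 1 ≤ (n : ℝ) ^ β := Real.one_le_rpow
    (by exact_mod_cast (Nat.succ_le_of_lt ((Nat.zero_le m).trans_lt (hmn n hn)))) hβ0.le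
  have hsum : ∑ i ∈ Finset.range D, ((D : ℝ) - i) * v (i + 1) n =
      (D - m) * n + m * (m + 1) := by
    have h1 := hR.sum_sub_mul_numDegree hd (hmn n hn)
    rw [hD, hdD] at h1
    simp only [hv]
    convert h1 using 1
    · exact Finset.sum_congr rfl fun i _ => by ring
    · ring
  obtain ⟨h1, h2⟩ := abs_sub_profile_le (u := fun i => v i n) (N := n)
    (B := K * (n : ℝ) ^ β) hD0 hw1 hwx hxw (by positivity) (hK n hn) hsum
  have hbound : |(m : ℝ) * (m + 1)| + (D ^ 3 + D) * (K * (n : ℝ) ^ β) ≤ K' * (n : ℝ) ^ β := by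
    rw [abs_of_pos (by positivity), hK']
    have := le_mul_of_one_le_right (by positivity : (0 : ℝ) ≤ m * (m + 1)) hpow
    linarith
  rw [Finset.mem_Icc] at hk
  obtain hkd | hkd := hk.2.eq_or_lt
  · have h3 : (numDegree k (G n ω) : ℝ) - limitProportion m d x k * n =
        -(m * (v 0 n - (w - 1) * n)) := by
      rw [hkd, hR.numDegree_top hd, limitProportion, if_pos rfl]
      have h4 : (m : ℝ) * v 0 n = E n := by simp only [hv]; field_simp
      simp only [hE] at h4
      linear_combination h4 - n * hwx
    rw [h3, abs_neg, abs_mul, abs_of_pos hm0]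
    have h5 : |v 0 n - (w - 1) * n| ≤ (w * K' + K) * (n : ℝ) ^ β := by
      have := mul_le_mul_of_nonneg_left hbound (by linarith : 0 ≤ w)
      linarith
    have h6 := mul_le_mul_of_nonneg_left h5 hm0.le
    have h7 : 0 ≤ K' * (n : ℝ) ^ β := by positivity
    linarith
  · obtain ⟨i, rfl⟩ := Nat.exists_eq_add_of_le hk.1
    have h3 := (h1 i (by omega)).trans hbound
    rw [hlim i hkd]
    have h4 : 0 ≤ m * (w * K' + K) * (n : ℝ) ^ β := by
      have : 0 ≤ w := by linarith
      positivity
    rw [add_mul]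
    exact h3.trans (le_add_of_nonneg_right h4)

theorem isLittleO_and_tendsto_of_abs_sub_le {N : ℕ → ℝ} {ρ : ℝ}
    (h : ∀ β : ℝ, 1 / 2 < β → β ≤ 1 →
      ∃ K, ∀ᶠ n : ℕ in atTop, |N n - ρ * n| ≤ K * (n : ℝ) ^ β) :
    Tendsto (fun n : ℕ => N n / n) atTop (𝓝 ρ) ∧ ∀ δ : ℝ, 0 < δ →
      (fun n : ℕ => |N n / n - ρ|) =o[atTop] fun n : ℕ => (n : ℝ) ^ (-(1 / 2 : ℝ) + δ) := by
  have hlittle : ∀ δ : ℝ, 0 < δ →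
      (fun n : ℕ => |N n / n - ρ|) =o[atTop] fun n : ℕ => (n : ℝ) ^ (-(1 / 2 : ℝ) + δ) := by
    intro δ hδ
    obtain ⟨δ', hδ', h1, h2⟩ : ∃ δ' : ℝ, 0 < δ' ∧ δ' < δ ∧ δ' ≤ 1 / 2 :=
      ⟨min (δ / 2) (1 / 2), by positivity, (min_le_left _ _).trans_lt (by linarith),
        min_le_right _ _⟩
    obtain ⟨K, hK⟩ := h (1 / 2 + δ') (by linarith) (by linarith)
    have hO : (fun n : ℕ => |N n / n - ρ|) =O[atTop]
        fun n : ℕ => (n : ℝ) ^ (-(1 / 2 : ℝ) + δ') := by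
      refine IsBigO.of_bound K ?_
      filter_upwards [hK, eventually_gt_atTop 0] with n hn hn0
      have hn0' : (0 : ℝ) < n := by exact_mod_cast hn0
      rw [Real.norm_of_nonneg (abs_nonneg _), Real.norm_of_nonneg (by positivity)]
      have h3 : N n / n - ρ = (N n - ρ * n) / n := by field_simp
      rwa [h3, abs_div, abs_of_pos hn0', div_le_iff₀ hn0', mul_assoc,
        ← Real.rpow_add_one hn0'.ne', (by ring : -(1 / 2 : ℝ) + δ' + 1 = 1 / 2 + δ')]
    refine hO.trans_isLittleO (isLittleO_of_tendsto' ?_ ?_)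
    · filter_upwards [eventually_gt_atTop 0] with n hn0 h3
      have : (0 : ℝ) < (n : ℝ) ^ (-(1 / 2 : ℝ) + δ) :=
        Real.rpow_pos_of_pos (by exact_mod_cast hn0) _
      exact absurd h3 this.ne'
    · refine ((tendsto_rpow_neg_atTop (sub_pos.2 h1)).comp
        tendsto_natCast_atTop_atTop).congr' ?_
      filter_upwards [eventually_gt_atTop 0] with n hn0
      rw [← Real.rpow_sub (by exact_mod_cast hn0), Function.comp]
      congr 1
      ring
  refine ⟨?_, hlittle⟩
  have h1 : Tendsto (fun n : ℕ => (n : ℝ) ^ (-(1 / 2 : ℝ) + 1 / 4)) atTop (𝓝 0) := by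
    have := (tendsto_rpow_neg_atTop (by norm_num : (0 : ℝ) < 1 / 4)).comp
      (tendsto_natCast_atTop_atTop (R := ℝ))
    refine this.congr fun n => ?_
    norm_num
  have h2 := (hlittle (1 / 4) (by norm_num)).trans_tendsto h1
  rw [tendsto_iff_dist_tendsto_zero]
  simpa [Real.dist_eq] using h2

theorem mainTheorem2 {Ω : Type*} [MeasurableSpace Ω] (μ : Measure Ω) [IsProbabilityMeasure μ]
    (m d : ℕ) (hm : 1 ≤ m) (hd : 2 * m < d)
    (G : (n : ℕ) → Ω → SimpleGraph (Fin n)) (hG : IsBoundedUniformAttachment μ m d G) :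
    (∃! x : ℝ, IsTopRoot m d x) ∧
    ∀ x : ℝ, IsTopRoot m d x →
      ∀ᵐ ω ∂μ, ∀ k ∈ Finset.Icc m d,
        Tendsto (fun n : ℕ => (numDegree k (G n ω) : ℝ) / n) atTop
          (𝓝 (limitProportion m d x k)) ∧
        ∀ δ : ℝ, 0 < δ →
          (fun n : ℕ => |(numDegree k (G n ω) : ℝ) / n - limitProportion m d x k|)
            =o[atTop] fun n : ℕ => (n : ℝ) ^ (-(1 / 2 : ℝ) + δ) := by
  refine ⟨existsUnique_isTopRoot hm hd, fun x hx => ?_⟩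
  have hM : ∀ᵐ ω ∂μ, ∀ k j : ℕ, ∀ᶠ n : ℕ in atTop,
      |compensated m d G (fun _ H => (numDegree k H : ℝ)) n ω| <
        (n : ℝ) ^ (1 / 2 + 1 / ((j : ℝ) + 1)) := by
    rw [ae_all_iff]
    intro k
    rw [ae_all_iff]
    intro j
    refine hG.ae_eventually_abs_compensated_lt hd _ (c := m + 1) (by positivity)
      (fun n H S hS => ?_) (by positivity)
    rw [← (Finset.mem_powersetCard.1 hS).2]
    exact abs_numDegree_addVertex_sub_le k H S
  filter_upwards [hM, hG.ae_reachable hd] with ω hω hreach k hk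
  refine isLittleO_and_tendsto_of_abs_sub_le fun β hβ hβ1 => ?_
  obtain ⟨j, hj⟩ := exists_nat_one_div_lt (sub_pos.2 hβ)
  obtain ⟨K, hK⟩ := exists_abs_numDegree_sub_le hm hd hreach hx (by linarith : 0 < β) hβ1
    (fun k => by
      filter_upwards [hω k j, eventually_ge_atTop 1] with n hn hn1
      exact hn.le.trans (Real.rpow_le_rpow_of_exponent_le (by exact_mod_cast hn1)
        (by linarith)))
  exact ⟨K, hK.mono fun n hn => hn k hk⟩
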